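/- **Setting.** Consider the mixed-integer linear program of minimizing $a^Tx+d^T\tilde y$ over $x\in X\subset\mathbb R^n$, $\tilde y\in\mathbb Z^m$ subject to $Ex+F\tilde y\le h$, $y^\ell\le\tilde y\le y^u$, with $E\in\mathbb R^{p\times n}$, $F\in\mathbb Z^{p\times m}$, $h\in\mathbb R^p$, $y^\ell,y^u\in\mathbb Z^m$, where $X=X_1\times\cdots\times X_n$ is non-empty, compact and convex. Let $e_l^T,f_l^T$ be the rows of $E,F$; put $\omega_l=0$ if $e_l\ne0$, and otherwise let $\omega_l$ be the gcd of the non-zero entries of $f_l$ ($0$ if there are none). Put $\lfloor s\rfloor_w=\max\{t\in w\mathbb Z: t\le s\}$ for $w\neq 0$, $\lfloor s\rfloor_0=s$, $b_l=\lfloor h_l\rfloor_{\omega_l}$, $\rho_l=\|f_l\|_1$, and $\xi_e=\max\{(h_l-b_l)/\omega_l:\omega_l\ne0\}$ ($\xi_e=0$ if $\omega=0$). For $\xi\in[\xi_e,1)$ let $\nu=\xi\omega-\frac12\rho$, $A=(E\ F)$, $c=(a,d)$, $z=(x,y)$, $Y_\xi=\prod_j[y^\ell_j+\frac12-\xi,\;y^u_j+\xi-\frac12]$,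 $Z=X\times Y_\xi$, $r=\max_{z\in Z}\|z\|$, and let $g_\xi(z)\le0$ denote the constraints $Az-b-\nu\le0$, $y\in Y_\xi$. Assume Slater's condition: $\bar z=(\bar x,\bar y)$ with $\bar x\in X$ satisfies $g_{\xi_e}(\bar z)<0$ componentwise. Fix $\xi\in[\xi_e,1)$, $\alpha,\delta>0$, $\phi\ge0$, $\kappa=(\alpha,\delta,\phi)$, and let $$L_\kappa(z,\lambda)=c^Tz+\tfrac\alpha2\|z\|^2+\lambda^T(Az-b-\nu-\phi\mathbf 1)-\tfrac\delta2\|\lambda\|^2 ,\qquad \Lambda=\{\lambda\in\mathbb R^p_+:\|\lambda\|_1\le M\},$$ $$M=\frac{c^T\bar z+\frac\alpha2\|\bar z\|^2+\|c\|r}{\min_{1\le l\le p}(-A_l\bar z+b_l+\nu_l+\phi)} ,$$ and let $(\hat z_\kappa,\hat\lambda_\kappa)$ be the saddle point (min in $z$, max in $\lambda$) of $L_\kappa$ over $Z\times\Lambda$. **Algorithm 1.** The entries of $z$ are partitioned into blocks $z_{[i]}$, $i=1,\dots,N_1$ (primal agents), constrained to the product $Z_i$ of the corresponding factors of $Z$;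 the entries of $\lambda$ are partitioned into blocks $\lambda_{[q]}$, $q=1,\dots,N_2$ (dual agents), constrained to $\Lambda_q=\{\lambda_{[q]}\ge0:\|\lambda_{[q]}\|_1\le M\}$. For $k=0,1,2,\dots$, primal agent $i$ sets $z^i_{[i]}(k+1)=\Pi_{Z_i}[z^i_{[i]}(k)-\gamma\nabla_{z_{[i]}}L_\kappa(z^i(k),\lambda^i(k))]$ if $k\in K^i$, and $z^i_{[i]}(k+1)=z^i_{[i]}(k)$ otherwise. For $t\in D\subseteq\{1,2,\dots\}$, each dual agent $q$ sets $\lambda^q_{[q]}(tB)=\Pi_{\Lambda_q}[\lambda^q_{[q]}(tB-1)+\beta\nabla_{\lambda_{[q]}}L_\kappa(z^q(tB),\lambda^q(tB-1))]$, and $\lambda^q_{[q]}$ is constant between these times. The initial blocks satisfy $z^i_{[i]}(0)\in Z_i$ and $\lambda^q_{[q]}(0)\in\Lambda_q$. Agents $i$ and $q$ communicate iff some entry of $z_{[i]}$ appears in a constraint belonging to $\lambda_{[q]}$; then $z^q_{[i]}(tB)=z^i_{[i]}(tB)$ for $t\in D$ and $\lambda^i_{[q]}(k)=\lambda^q_{[q]}(k)$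 for all $k$. Assume partial asynchrony: $B\ge1$, and for every $i$ and every $k\ge0$ at least one of $k,\dots,k+B-1$ lies in $K^i$. Let $z(k)$, $\lambda(k)$ be the vectors with blocks $z^i_{[i]}(k)$, $\lambda^q_{[q]}(k)$, let $t_n$ be the $n$-th smallest element of $D$, and $t_0=0$. **Theorem (Overall Primal Convergence).** There exist constants $\gamma_1>0$ and $\theta>0$, depending only on the program and on $\xi,\bar z,\alpha,\delta,\phi$, such that for all stepsizes $\gamma\in(0,\gamma_1)$ and $$0<\beta<\min\Big\{\frac{2\alpha}{\|A\|_2+2\alpha\delta},\frac{2\delta}{1+\delta^2}\Big\},$$ the numbers $q_p=1-\theta\gamma$ and $q_d=(1-\beta\delta)^2+\beta^2$ lie in $[0,1)$ and, for every run of Algorithm 1 and every $n\ge1$ for which $t_n$ exists, the primal iterates converge linearly between dual updates, i.e. with $\hat z(t_{n-1}B)=\arg\min_{z\in Z}L_\kappa(z,\lambda(t_{n-1}B))$, $$\|z(t_nB)-\hat z(t_{n-1}B)\|\le q_p^{\,t_n-t_{n-1}}\|z(t_{n-1}B)-\hat z(t_{n-1}B)\|,$$ and $$\|z(t_nB)-\hat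 z_\kappa\|\le 2q_p^{\,t_n-t_{n-1}}r+\frac{\|A\|_2}{\alpha}\Big(q_d^{\,n-1}\|\lambda(0)-\hat\lambda_\kappa\|^2+\big(4r^2q_dq_p^2\|A\|_2^2+8r^2\beta^2q_p\|A\|_2^2\big)\sum_{i=0}^{n-1}q_d^{\,i}\Big)^{1/2}.$$ -/

import Mathlib

/-- Euclidean space of primal vectors `z = (x, y) ∈ ℝ^(n+m)`. -/
abbrev PrimalVec (n m : ℕ) := EuclideanSpace ℝ (Fin n ⊕ Fin m)

/-- Euclidean space of dual vectors `λ ∈ ℝ^p`. -/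
abbrev DualVec (p : ℕ) := EuclideanSpace ℝ (Fin p)

/-- Data of the mixed-integer linear program
minimize `aᵀ x + dᵀ y` over `x ∈ X = X₁ × ⋯ × Xₙ`, `y ∈ ℤ^m`,
subject to `E x + F y ≤ h` and `yl ≤ y ≤ yu`. -/
structure MILP (n m p : ℕ) where
  a : Fin n → ℝ
  d : Fin m → ℝ
  E : Matrix (Fin p) (Fin n) ℝ
  F : Matrix (Fin p) (Fin m) ℤ
  h : Fin p → ℝ
  yl : Fin m → ℤ
  yu : Fin m → ℤ
  Xfac : Fin n → Set ℝ

/-- The largest element of `w ℤ` that is at most `s`; by convention it is `s` if `w = 0`. -/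
noncomputable def floorMult (s : ℝ) (w : ℕ) : ℝ :=
  if w = 0 then s else (w : ℝ) * (⌊s / (w : ℝ)⌋ : ℝ)

theorem floorMult_isGreatest (s : ℝ) {w : ℕ} (hw : w ≠ 0) :
    IsGreatest {t : ℝ | (∃ k : ℤ, t = (w : ℝ) * (k : ℝ)) ∧ t ≤ s} (floorMult s w) := by
  have hpos : (0 : ℝ) < (w : ℝ) := by exact_mod_cast Nat.pos_of_ne_zero hw
  rw [floorMult, if_neg hw]
  refine ⟨⟨⟨_, rfl⟩, ?_⟩, ?_⟩
  · have h1 : ((⌊s / (w : ℝ)⌋ : ℤ) : ℝ) ≤ s / (w : ℝ) := Int.floor_le _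
    rw [le_div_iff₀ hpos] at h1
    linarith
  · rintro t ⟨⟨k, rfl⟩, ht⟩
    have h2 : k ≤ ⌊s / (w : ℝ)⌋ := by
      rw [Int.le_floor, le_div_iff₀ hpos]
      linarith
    have h3 : (k : ℝ) ≤ ((⌊s / (w : ℝ)⌋ : ℤ) : ℝ) := by exact_mod_cast h2
    exact mul_le_mul_of_nonneg_left h3 hpos.le

/-- `p` is the Euclidean projection of `v` onto `S`. -/
def IsProjOn {ι : Type*} [Fintype ι] (S : Set (EuclideanSpace ℝ ι))
    (v p : EuclideanSpace ℝ ι) : Prop :=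
  p ∈ S ∧ ∀ s ∈ S, ‖v - p‖ ≤ ‖v - s‖

/-- The block `v_[i]` of a vector `v`: its entries at the indices that `own` assigns to agent
`i`. -/
noncomputable def block {ι : Type*} {N : ℕ} (own : ι → Fin N) (i : Fin N)
    (v : EuclideanSpace ℝ ι) : EuclideanSpace ℝ {j : ι // own j = i} :=
  WithLp.toLp 2 (fun j => v j.1)

/-- The stacked vector whose block `i` is the block `i` of the vector stored by agent `i`. -/
noncomputable def stack {ι : Type*} {N : ℕ} (own : ι → Fin N)
    (v : Fin N → ℕ → EuclideanSpace ℝ ι) (k : ℕ) : EuclideanSpace ℝ ι :=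
  WithLp.toLp 2 (fun j => v (own j) k j)

/-- The `n`-th smallest element `t_n` of `D` for `n ≥ 1`, with `t_0 = 0`. -/
noncomputable def dualTime (D : Set ℕ) : ℕ → ℕ
  | 0 => 0
  | n + 1 => Nat.nth (fun t => t ∈ D) n

/-- Partial asynchrony: every primal agent computes at least once in any `B` consecutive time
steps. -/
def PartiallyAsync {N : ℕ} (K : Fin N → Set ℕ) (B : ℕ) : Prop :=
  0 < B ∧ ∀ i k, ∃ l, k ≤ l ∧ l < k + B ∧ l ∈ K i

namespace MILP

variable {n m p : ℕ} (P : MILP n m p)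

/-- The set `X = X₁ × ⋯ × Xₙ`. -/
def X : Set (EuclideanSpace ℝ (Fin n)) := {x | ∀ i, x i ∈ P.Xfac i}

/-- The set `X = X₁ × ⋯ × Xₙ` is non-empty, compact and convex. -/
structure CompactConvex : Prop where
  nonempty : P.X.Nonempty
  compact : IsCompact P.X
  convex : Convex ℝ P.X

/-- `ω_l` is `0` if row `l` of `E` is non-zero, and otherwise it is the gcd of the non-zero
entries of row `l` of `F` (zero entries do not change a gcd; the gcd of no entries is `0`). -/
noncomputable def omega (l : Fin p) : ℕ :=
  open Classical in if P.E l = 0 then Finset.univ.gcd (fun j => (P.F l j).natAbs) else 0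

/-- `ρ_l` is the 1-norm of row `l` of `F`. -/
noncomputable def rho (l : Fin p) : ℝ := ∑ j, |(P.F l j : ℝ)|

/-- `b = ⌊h⌋_ω`. -/
noncomputable def b (l : Fin p) : ℝ := floorMult (P.h l) (P.omega l)

/-- `ν = ξ ω - ρ / 2`. -/
noncomputable def nu (ξ : ℝ) (l : Fin p) : ℝ := ξ * (P.omega l : ℝ) - (1 / 2) * P.rho l

/-- `ξ_e = max {(h_l - ⌊h_l⌋_{ω_l}) / ω_l : ω_l ≠ 0}` if `ω ≠ 0`, and `ξ_e = 0` otherwise. -/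
noncomputable def xiE : ℝ :=
  open Classical in
  if P.omega = 0 then 0
  else sSup {s : ℝ | ∃ l, P.omega l ≠ 0 ∧ s = (P.h l - P.b l) / (P.omega l : ℝ)}

/-- `A = (E F)`. -/
noncomputable def A : Matrix (Fin p) (Fin n ⊕ Fin m) ℝ :=
  Matrix.fromCols P.E (P.F.map (fun k : ℤ => (k : ℝ)))

/-- The spectral norm `‖A‖₂`. -/
noncomputable def normA : ℝ := ‖(Matrix.toEuclideanLin P.A).toContinuousLinearMap‖

/-- `c = (a, d)`. -/
noncomputable def c : PrimalVec n m := WithLp.toLp 2 (Sum.elim P.a P.d)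

/-- The entry `l` of `A z`. -/
noncomputable def Amul (z : PrimalVec n m) (l : Fin p) : ℝ := ∑ j, P.A l j * z j

/-- `cᵀ z`. -/
noncomputable def cost (z : PrimalVec n m) : ℝ := ∑ j, P.c j * z j

/-- The constraint function `g_ξ` of the relaxed linear program. -/
noncomputable def g (ξ : ℝ) (z : PrimalVec n m) : Fin p ⊕ (Fin m ⊕ Fin m) → ℝ :=
  Sum.elim (fun l => P.Amul z l - P.b l - P.nu ξ l)
    (Sum.elim (fun j => z (Sum.inr j) - (P.yu j : ℝ) - (ξ - 1 / 2))
      (fun j => - z (Sum.inr j) + (P.yl j : ℝ) + (1 / 2 - ξ)))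

/-- `zbar = (xbar, ybar)` is a Slater point of `g_{ξ_e}`. -/
structure IsSlater (zbar : PrimalVec n m) : Prop where
  mem : ∀ i, zbar (Sum.inl i) ∈ P.Xfac i
  neg : ∀ l, P.g P.xiE zbar l < 0

/-- The factor of `Z = X₁ × ⋯ × Xₙ × Y₁ × ⋯ × Y_m` at a coordinate, where
`Y_j = [yl_j + (1/2 - ξ), yu_j + (ξ - 1/2)]`. -/
def Zfac (ξ : ℝ) : Fin n ⊕ Fin m → Set ℝ :=
  Sum.elim P.Xfac
    (fun j => Set.Icc ((P.yl j : ℝ) + (1 / 2 - ξ)) ((P.yu j : ℝ) + (ξ - 1 / 2)))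

/-- `Z = X × Y_ξ`. -/
def Z (ξ : ℝ) : Set (PrimalVec n m) := {z | ∀ j, z j ∈ P.Zfac ξ j}

/-- `r = max {‖z‖ : z ∈ Z}`. -/
noncomputable def r (ξ : ℝ) : ℝ := sSup ((fun z : PrimalVec n m => ‖z‖) '' P.Z ξ)

/-- The regularized Lagrangian
`L_κ(z, λ) = cᵀ z + (α/2)‖z‖² + λᵀ(A z - b - ν - φ 1) - (δ/2)‖λ‖²`. -/
noncomputable def L (ξ α δ φ : ℝ) (z : PrimalVec n m) (lam : DualVec p) : ℝ :=
  P.cost z + α / 2 * ‖z‖ ^ 2 + ∑ l, lam l * (P.Amul z l - P.b l - P.nu ξ l - φ)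
    - δ / 2 * ‖lam‖ ^ 2

/-- The bound on the 1-norm of dual vectors,
`(cᵀ zbar + (α/2)‖zbar‖² + ‖c‖ r) / min_l (-A_l zbar + b_l + ν_l + φ)`. -/
noncomputable def dualBound (ξ α φ : ℝ) (zbar : PrimalVec n m) : ℝ :=
  (P.cost zbar + α / 2 * ‖zbar‖ ^ 2 + ‖P.c‖ * P.r ξ) /
    (⨅ l : Fin p, (- P.Amul zbar l + P.b l + P.nu ξ l + φ))

/-- The dual set `Λ`. -/
def Lam (ξ α φ : ℝ) (zbar : PrimalVec n m) : Set (DualVec p) :=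
  {lam | (∀ l, 0 ≤ lam l) ∧ ∑ l, |lam l| ≤ P.dualBound ξ α φ zbar}

/-- `(zhat, lamhat)` is a saddle point of `L_κ` over `Z × Λ`. -/
structure IsSaddle (ξ α δ φ : ℝ) (zbar zhat : PrimalVec n m) (lamhat : DualVec p) : Prop where
  memZ : zhat ∈ P.Z ξ
  memLam : lamhat ∈ P.Lam ξ α φ zbar
  max_dual : ∀ lam ∈ P.Lam ξ α φ zbar, P.L ξ α δ φ zhat lam ≤ P.L ξ α δ φ zhat lamhat
  min_primal : ∀ z ∈ P.Z ξ, P.L ξ α δ φ zhat lamhat ≤ P.L ξ α δ φ z lamhat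

/-- `∇_z L_κ(z, λ)`. -/
noncomputable def gradZ (ξ α δ φ : ℝ) (z : PrimalVec n m) (lam : DualVec p) : PrimalVec n m :=
  gradient (fun z' => P.L ξ α δ φ z' lam) z

/-- `∇_λ L_κ(z, λ)`. -/
noncomputable def gradLam (ξ α δ φ : ℝ) (z : PrimalVec n m) (lam : DualVec p) : DualVec p :=
  gradient (fun lam' => P.L ξ α δ φ z lam') lam

/-- The set `Z_i` that constrains the block of primal agent `i`. -/
def Zblock (ξ : ℝ) {N₁ : ℕ} (ownP : Fin n ⊕ Fin m → Fin N₁) (i : Fin N₁) :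
    Set (EuclideanSpace ℝ {j // ownP j = i}) :=
  {v | ∀ j, v j ∈ P.Zfac ξ j.1}

/-- The set `Λ_q` that constrains the block of dual agent `q`. -/
def LamBlock (ξ α φ : ℝ) (zbar : PrimalVec n m) {N₂ : ℕ} (ownD : Fin p → Fin N₂)
    (q : Fin N₂) : Set (EuclideanSpace ℝ {l // ownD l = q}) :=
  {v | (∀ l, 0 ≤ v l) ∧ ∑ l, |v l| ≤ P.dualBound ξ α φ zbar}

/-- Primal agent `i` and dual agent `q` are essential neighbors: some entry of `z_[i]` appears
in some constraint of dual agent `q`. -/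
def Essential {N₁ N₂ : ℕ} (ownP : Fin n ⊕ Fin m → Fin N₁) (ownD : Fin p → Fin N₂)
    (i : Fin N₁) (q : Fin N₂) : Prop :=
  ∃ l j, ownD l = q ∧ ownP j = i ∧ P.A l j ≠ 0

/-- The trajectories produced by the distributed algorithm with primal stepsize `γ` and dual
stepsize `β`. Primal agent `i` updates the block `z_[i]` at the times in `K i`, and all dual agents
update at the times `t * B` with `t ∈ D`. At time `k` primal agent `i` stores `zP i k` and
`lamP i k`, and dual agent `q` stores `zD q k` and `lamD q k`. Agents exchange values with their
essential neighbors only; the entries of stored vectors that are neither computed nor received are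
unconstrained. All primal agents use the current values of the dual blocks they need. -/
structure IsRun (ξ α δ φ γ β : ℝ) (zbar : PrimalVec n m) {N₁ N₂ : ℕ}
    (ownP : Fin n ⊕ Fin m → Fin N₁) (ownD : Fin p → Fin N₂)
    (B : ℕ) (K : Fin N₁ → Set ℕ) (D : Set ℕ)
    (zP : Fin N₁ → ℕ → PrimalVec n m) (lamP : Fin N₁ → ℕ → DualVec p)
    (zD : Fin N₂ → ℕ → PrimalVec n m) (lamD : Fin N₂ → ℕ → DualVec p) : Prop where
  z_init : ∀ i, block ownP i (zP i 0) ∈ P.Zblock ξ ownP i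
  lam_init : ∀ q, block ownD q (lamD q 0) ∈ P.LamBlock ξ α φ zbar ownD q
  z_step : ∀ i, ∀ k ∈ K i,
    IsProjOn (P.Zblock ξ ownP i)
      (block ownP i (zP i k) - γ • block ownP i (P.gradZ ξ α δ φ (zP i k) (lamP i k)))
      (block ownP i (zP i (k + 1)))
  z_hold : ∀ i k, k ∉ K i → block ownP i (zP i (k + 1)) = block ownP i (zP i k)
  lam_step : ∀ q, ∀ t ∈ D,
    IsProjOn (P.LamBlock ξ α φ zbar ownD q)
      (block ownD q (lamD q (t * B - 1)) +
        β • block ownD q (P.gradLam ξ α δ φ (zD q (t * B)) (lamD q (t * B - 1))))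
      (block ownD q (lamD q (t * B)))
  lam_hold : ∀ q k, (∀ t ∈ D, k + 1 ≠ t * B) →
    block ownD q (lamD q (k + 1)) = block ownD q (lamD q k)
  send_primal : ∀ i q, P.Essential ownP ownD i q → ∀ t ∈ D,
    block ownP i (zD q (t * B)) = block ownP i (zP i (t * B))
  send_dual : ∀ i q, P.Essential ownP ownD i q → ∀ k,
    block ownD q (lamP i k) = block ownD q (lamD q k)

end MILP

/-! The Hessian of the Lagrangian in `z` is `α • 1`. Hence, for fixed `λ`, the gradient block of a
primal agent depends only on its own block of `z`, and a projected gradient step contracts the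
distance of that block to the minimizer by exactly `1 - αγ` before projection. No coupling between
primal blocks remains, so asynchrony costs nothing beyond counting: each of the `t_n - t_{n-1}`
windows of length `B` contains an update of every agent. This gives `θ = α`
(`IsRun.primal_contraction`).

For the dual error, a step is compared with the same step taken at the saddle point. The sets `Λ_q`
use the full bound `M` each, so their product may exceed `Λ`; Slater's condition makes the bound
inactive at the dual solution when `M > 0`, and the optimality condition extends to the product
(`IsSaddle.inner_le_zero`). Nonexpansiveness then reduces the step to an unprojected one.

The recursion with factor `q_d` (`CompactConvex.dual_recursion`) has two regimes, separated by `β₀ =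
2α/(‖A‖² + 2αδ)`; the assumed bound on `β` has `‖A‖` in place of `‖A‖²`, so it may allow `β > β₀`.
For `β ≤ β₀`, co-coercivity of the map from `λ` to the primal minimizer absorbs the ideal part of
the primal error. For `β ≥ β₀`, the diameter bound `2r` suffices: `γ₁` is so small that `q_p` is
near `1`, and the additive constant already dominates the crude estimate.

Finally, the minimizer is Lipschitz in `λ` with constant `‖A‖/α`, which carries the dual bound to
the primal iterates. -/

theorem euclidean_inner_eq_sum {ι : Type*} [Fintype ι] (x y : EuclideanSpace ℝ ι) :
    inner ℝ x y = ∑ i, x i * y i := by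
  rw [PiLp.inner_apply]
  exact Finset.sum_congr rfl fun i _ => by simp [mul_comm]

/-! ### Quadratic functions and variational inequalities -/

section Quadratic

variable {V : Type*} [NormedAddCommGroup V] [InnerProductSpace ℝ V]

/-- The gradient of a quadratic function whose Hessian is a multiple of the identity. -/
theorem hasGradientAt_quadratic [CompleteSpace V] (k s : ℝ) (g z : V) :
    HasGradientAt (fun x => k + inner ℝ g x + s / 2 * ‖x‖ ^ 2) (g + s • z) z := by
  rw [hasGradientAt_iff_hasFDerivAt]
  have h1 : HasFDerivAt (fun x : V => inner ℝ g x) (innerSL ℝ g) z :=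
    (innerSL ℝ g).hasFDerivAt
  have h2 := (hasStrictFDerivAt_norm_sq (F := V) z).hasFDerivAt
  have h3 := ((h1.const_add k).add (h2.const_mul (s / 2)))
  refine h3.congr_fderiv ?_
  ext x
  simp
  ring

/-- The limit `t → 0`, made explicit by a `t` small enough to contradict `x < 0`. -/
theorem nonneg_of_forall_nonneg_add_mul {x k : ℝ} (h : ∀ t : ℝ, 0 < t → t ≤ 1 → 0 ≤ x + t * k) :
    0 ≤ x := by
  by_contra hx
  push Not at hx
  have hk : 0 < |k| + 1 - x := by have := abs_nonneg k; linarith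
  have ht : 0 < -x / (|k| + 1 - x) := by apply div_pos <;> linarith
  have h1 := h _ ht (by rw [div_le_one hk]; have := abs_nonneg k; linarith)
  have h2 : -x / (|k| + 1 - x) * k ≤ -x / (|k| + 1 - x) * |k| :=
    mul_le_mul_of_nonneg_left (le_abs_self k) ht.le
  have h3 : -x / (|k| + 1 - x) * (|k| + 1 - x) = -x := div_mul_cancel₀ _ hk.ne'
  nlinarith

/-- First order optimality condition for a quadratic function on a convex set. -/
theorem Convex.inner_nonneg_of_isMinOn_quadratic {S : Set V} (hS : Convex ℝ S) {k s : ℝ} {g v : V}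
    (hv : v ∈ S) (hmin : ∀ x ∈ S, k + inner ℝ g v + s / 2 * ‖v‖ ^ 2 ≤
      k + inner ℝ g x + s / 2 * ‖x‖ ^ 2) {x : V} (hx : x ∈ S) :
    0 ≤ inner ℝ (g + s • v) (x - v) := by
  refine nonneg_of_forall_nonneg_add_mul (k := s / 2 * ‖x - v‖ ^ 2) fun t ht ht1 => ?_
  have h1 := hmin _ (hS.add_smul_sub_mem hv hx ⟨ht.le, ht1⟩)
  rw [inner_add_right, inner_smul_right, norm_add_sq_real, inner_smul_right, norm_smul,
    Real.norm_of_nonneg ht.le] at h1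
  rw [inner_add_left, inner_smul_left]
  have h2 : 0 ≤ t * (inner ℝ g (x - v) + s * inner ℝ v (x - v) +
    t * (s / 2 * ‖x - v‖ ^ 2)) := by linarith
  simpa using nonneg_of_mul_nonneg_right h2 ht

/-- Nonexpansiveness of projections in a form that only tests `p` and `q` against each other. It
thus applies when `q` is a fixed point characterized by an optimality condition rather than by a
projection. -/
theorem norm_sub_le_of_variational {x y p q : V} (hp : inner ℝ (x - p) (q - p) ≤ 0)
    (hq : inner ℝ (y - q) (p - q) ≤ 0) : ‖p - q‖ ≤ ‖x - y‖ := by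
  have h1 : ‖p - q‖ ^ 2 ≤ inner ℝ (x - y) (p - q) := by
    rw [← real_inner_self_eq_norm_sq]
    have e1 : inner ℝ (x - p) (q - p) = - inner ℝ (x - p) (p - q) := by
      rw [← inner_neg_right, neg_sub]
    have e2 : inner ℝ (x - y) (p - q) =
        inner ℝ (x - p) (p - q) + inner ℝ (p - q) (p - q) - inner ℝ (y - q) (p - q) := by
      rw [← inner_add_left, ← inner_sub_left]
      congr 1
      abel
    linarith
  have h2 := real_inner_le_norm (x - y) (p - q)
  by_contra hlt
  push Not at hlt
  nlinarith [norm_nonneg (x - y)]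

/-- Cauchy–Schwarz; the defect is exactly `‖t • w - s • v‖ ^ 2`. With `s = 1 - βδ` and `t = β` the
factor is `q_d`. -/
theorem norm_sq_smul_add_smul_le (s t : ℝ) (w v : V) :
    ‖s • w + t • v‖ ^ 2 ≤ (s ^ 2 + t ^ 2) * (‖w‖ ^ 2 + ‖v‖ ^ 2) := by
  have h1 := norm_add_sq_real (s • w) (t • v)
  have h2 := norm_sub_sq_real (t • w) (s • v)
  simp only [inner_smul_left, inner_smul_right, norm_smul, mul_pow, Real.norm_eq_abs, sq_abs,
    conj_trivial] at h1 h2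
  nlinarith [sq_nonneg ‖t • w - s • v‖]

end Quadratic

theorem IsProjOn.inner_le_zero {ι : Type*} [Fintype ι] {S : Set (EuclideanSpace ℝ ι)}
    (hS : Convex ℝ S) {v p s : EuclideanSpace ℝ ι} (h : IsProjOn S v p) (hs : s ∈ S) :
    inner ℝ (v - p) (s - p) ≤ 0 := by
  have h1 := hS.inner_nonneg_of_isMinOn_quadratic (k := ‖v‖ ^ 2 / 2) (s := 1) (g := -v) h.1
    (fun x hx => ?_) hs
  · have e : -v + (1 : ℝ) • p = -(v - p) := by rw [one_smul]; abel
    rw [e, inner_neg_left] at h1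
    linarith
  · have h2 := h.2 x hx
    have h3 : ‖v - p‖ ^ 2 ≤ ‖v - x‖ ^ 2 := by gcongr
    rw [norm_sub_sq_real, norm_sub_sq_real] at h3
    rw [inner_neg_left, inner_neg_left]
    linarith

/-! ### Decomposition of vectors into agents' blocks -/

section Block

variable {ι : Type*} {N : ℕ} (own : ι → Fin N)

theorem block_add (i : Fin N) (u v : EuclideanSpace ℝ ι) :
    block own i (u + v) = block own i u + block own i v := rfl

theorem block_sub (i : Fin N) (u v : EuclideanSpace ℝ ι) :
    block own i (u - v) = block own i u - block own i v := rfl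

theorem block_smul (i : Fin N) (t : ℝ) (v : EuclideanSpace ℝ ι) :
    block own i (t • v) = t • block own i v := rfl

theorem block_stack (i : Fin N) (v : Fin N → ℕ → EuclideanSpace ℝ ι) (k : ℕ) :
    block own i (stack own v k) = block own i (v i k) := by
  ext ⟨j, rfl⟩
  rfl

theorem block_congr_iff {i : Fin N} {u v : EuclideanSpace ℝ ι} :
    block own i u = block own i v ↔ ∀ j, own j = i → u j = v j := by
  constructor
  · intro h j hj
    exact congrArg (fun w : EuclideanSpace ℝ {j : ι // own j = i} => w ⟨j, hj⟩) h
  · intro h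
    ext ⟨j, hj⟩
    exact h j hj

theorem inner_eq_sum_block [Fintype ι] (u v : EuclideanSpace ℝ ι) :
    inner ℝ u v = ∑ i, inner ℝ (block own i u) (block own i v) := by
  simp only [euclidean_inner_eq_sum]
  exact (Fintype.sum_fiberwise own fun j => u j * v j).symm

theorem norm_sq_eq_sum_block [Fintype ι] (v : EuclideanSpace ℝ ι) :
    ‖v‖ ^ 2 = ∑ i, ‖block own i v‖ ^ 2 := by
  simp only [← real_inner_self_eq_norm_sq]
  exact inner_eq_sum_block own v v

theorem norm_le_mul_of_block_le [Fintype ι] {c : ℝ} (hc : 0 ≤ c) {u v : EuclideanSpace ℝ ι}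
    (h : ∀ i, ‖block own i u‖ ≤ c * ‖block own i v‖) : ‖u‖ ≤ c * ‖v‖ := by
  have h1 : ‖u‖ ^ 2 ≤ (c * ‖v‖) ^ 2 := by
    rw [mul_pow, norm_sq_eq_sum_block own u, norm_sq_eq_sum_block own v, Finset.mul_sum]
    refine Finset.sum_le_sum fun i _ => ?_
    rw [← mul_pow]
    gcongr
    exact h i
  exact (abs_le_of_sq_le_sq' h1 (by positivity)).2

/-- Replacing a single block turns an optimality condition on the whole space into one on that
block. -/
theorem exists_block_eq [Fintype ι] (i : Fin N) (v : EuclideanSpace ℝ ι)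
    (s : EuclideanSpace ℝ {j : ι // own j = i}) :
    ∃ w : EuclideanSpace ℝ ι, (∀ j (hj : own j = i), w j = s ⟨j, hj⟩) ∧
      (∀ j, own j ≠ i → w j = v j) ∧
      ∀ g : EuclideanSpace ℝ ι, inner ℝ g (w - v) = inner ℝ (block own i g) (s - block own i v) := by
  let w : EuclideanSpace ℝ ι :=
    WithLp.toLp 2 (fun j => if h : own j = i then s ⟨j, h⟩ else v j)
  have h1 : ∀ j (hj : own j = i), w j = s ⟨j, hj⟩ := fun j hj => dif_pos hj
  have h2 : ∀ j, own j ≠ i → w j = v j := fun j hj => dif_neg hj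
  refine ⟨w, h1, h2, fun g => ?_⟩
  have e : block own i w = s := by
    ext ⟨j, hj⟩
    exact h1 j hj
  rw [inner_eq_sum_block own, Finset.sum_eq_single i, block_sub, e]
  · intro q _ hq
    have : block own q w = block own q v :=
      (block_congr_iff own).2 fun j hj => h2 j (by rw [hj]; exact hq)
    rw [block_sub, this, sub_self, inner_zero_right]
  · simp

theorem inner_le_zero_of_isProjOn_block [Fintype ι]
    {S : ∀ i, Set (EuclideanSpace ℝ {j : ι // own j = i})} (hS : ∀ i, Convex ℝ (S i))
    {v p s : EuclideanSpace ℝ ι} (h : ∀ i, IsProjOn (S i) (block own i v) (block own i p))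
    (hs : ∀ i, block own i s ∈ S i) : inner ℝ (v - p) (s - p) ≤ 0 := by
  rw [inner_eq_sum_block own]
  exact Finset.sum_nonpos fun i _ => (h i).inner_le_zero (hS i) (hs i)

end Block

/-! ### Counting windows and dual update times -/

/-- A sequence that never increases, and that shrinks by a factor `q` at least once in every
window of length `B`, decreases by `q ^ T` over `T` windows. -/
theorem le_pow_mul_of_windows {d : ℕ → ℝ} {q : ℝ} {B s T : ℕ} {K : Set ℕ} (hq : 0 ≤ q)
    (hK : ∀ k, ∃ l, k ≤ l ∧ l < k + B ∧ l ∈ K)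
    (hmono : ∀ k, s ≤ k → k < s + T * B → d (k + 1) ≤ d k)
    (hstep : ∀ k, s ≤ k → k < s + T * B → k ∈ K → d (k + 1) ≤ q * d k) :
    d (s + T * B) ≤ q ^ T * d s := by
  have anti : ∀ a j, s ≤ a → a + j ≤ s + T * B → d (a + j) ≤ d a := by
    intro a j ha
    induction j with
    | zero => intro _; exact le_rfl
    | succ j ih =>
      intro h
      exact (hmono (a + j) (by omega) (by omega)).trans (ih (by omega))
  suffices ∀ t, t ≤ T → d (s + t * B) ≤ q ^ t * d s from this T le_rfl
  intro t
  induction t with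
  | zero => intro _; simp
  | succ t ih =>
    intro ht
    have hT : (t + 1) * B ≤ T * B := Nat.mul_le_mul_right B ht
    rw [Nat.succ_mul] at hT ⊢
    obtain ⟨l, h1, h2, h3⟩ := hK (s + t * B)
    have e1 := anti (l + 1) (s + t * B + B - (l + 1)) (by omega) (by omega)
    rw [show l + 1 + (s + t * B + B - (l + 1)) = s + (t * B + B) by omega] at e1
    have e2 := anti (s + t * B) (l - (s + t * B)) (by omega) (by omega)
    rw [show s + t * B + (l - (s + t * B)) = l by omega] at e2
    calc d (s + (t * B + B)) ≤ d (l + 1) := e1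
      _ ≤ q * d l := hstep l (by omega) (by omega) h3
      _ ≤ q * (q ^ t * d s) := mul_le_mul_of_nonneg_left (e2.trans (ih (by omega))) hq
      _ = q ^ (t + 1) * d s := by ring

section DualTime

variable {D : Set ℕ}

/-- The cardinality hypothesis excludes the default value `0` of `Nat.nth` past the end of a finite
set. -/
theorem dualTime_mem {N : ℕ} (hN : ((N + 1 : ℕ) : ℕ∞) ≤ D.encard) : dualTime D (N + 1) ∈ D := by
  refine Nat.nth_mem (p := fun t => t ∈ D) N fun hf => ?_
  rw [show D.encard = ((hf.toFinset.card : ℕ) : ℕ∞) from hf.encard_eq_coe_toFinset_card] at hN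
  exact_mod_cast hN

theorem dualTime_lt_succ (h0 : 0 ∉ D) {N : ℕ} (hN : ((N + 1 : ℕ) : ℕ∞) ≤ D.encard) :
    dualTime D N < dualTime D (N + 1) := by
  cases N with
  | zero =>
    refine Nat.pos_of_ne_zero fun h => h0 ?_
    rw [← h]
    exact dualTime_mem hN
  | succ N =>
    refine Nat.nth_lt_nth' (p := fun t => t ∈ D) (Nat.lt_succ_self N) fun hf => ?_
    rw [show D.encard = ((hf.toFinset.card : ℕ) : ℕ∞) from hf.encard_eq_coe_toFinset_card] at hN
    exact_mod_cast hN

theorem le_dualTime_of_lt_succ {N t : ℕ} (ht : t ∈ D)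
    (hlt : t < dualTime D (N + 1)) : t ≤ dualTime D N := by
  cases N with
  | zero =>
    have h : dualTime D 1 ≤ t := by
      change Nat.nth (fun t => t ∈ D) 0 ≤ t
      rw [Nat.nth_zero]
      exact Nat.sInf_le ht
    exact absurd hlt (not_lt.2 h)
  | succ N => exact Nat.le_nth_of_lt_nth_succ hlt ht

end DualTime

/-! ### The Lagrangian as a quadratic function of each argument -/

namespace MILP

variable {n m p : ℕ} (P : MILP n m p)

/-- The linear map `z ↦ A z` between Euclidean spaces. -/
noncomputable def opA : PrimalVec n m →L[ℝ] DualVec p :=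
  (Matrix.toEuclideanLin P.A).toContinuousLinearMap

/-- The vector `Aᵀ λ`. -/
noncomputable def adjA (lam : DualVec p) : PrimalVec n m :=
  WithLp.toLp 2 (fun j => ∑ l, P.A l j * lam l)

/-- The right-hand side `b + ν + φ 1` of the tightened constraints. -/
noncomputable def rhs (ξ φ : ℝ) : DualVec p := WithLp.toLp 2 (fun l => P.b l + P.nu ξ l + φ)

theorem opA_apply (z : PrimalVec n m) (l : Fin p) : P.opA z l = P.Amul z l := by
  simp [opA, Amul, Matrix.toLpLin_apply, Matrix.mulVec, dotProduct]

theorem adjA_apply (lam : DualVec p) (j : Fin n ⊕ Fin m) :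
    P.adjA lam j = ∑ l, P.A l j * lam l := rfl

theorem rhs_apply (ξ φ : ℝ) (l : Fin p) : P.rhs ξ φ l = P.b l + P.nu ξ l + φ := rfl

theorem norm_opA_le (z : PrimalVec n m) : ‖P.opA z‖ ≤ P.normA * ‖z‖ := P.opA.le_opNorm z

theorem normA_nonneg : 0 ≤ P.normA := norm_nonneg _

theorem inner_adjA (lam : DualVec p) (z : PrimalVec n m) :
    inner ℝ (P.adjA lam) z = inner ℝ lam (P.opA z) := by
  simp only [euclidean_inner_eq_sum, opA_apply, Amul, adjA_apply, Finset.sum_mul, Finset.mul_sum]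
  rw [Finset.sum_comm]
  exact Finset.sum_congr rfl fun l _ => Finset.sum_congr rfl fun j _ => by ring

theorem cost_eq_inner (z : PrimalVec n m) : P.cost z = inner ℝ P.c z :=
  (euclidean_inner_eq_sum _ _).symm

theorem sum_mul_constraint (ξ φ : ℝ) (z : PrimalVec n m) (lam : DualVec p) :
    ∑ l, lam l * (P.Amul z l - P.b l - P.nu ξ l - φ) = inner ℝ (P.opA z - P.rhs ξ φ) lam := by
  rw [euclidean_inner_eq_sum]
  refine Finset.sum_congr rfl fun l _ => ?_
  rw [PiLp.sub_apply, opA_apply, rhs_apply]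
  ring

theorem L_eq_dual (ξ α δ φ : ℝ) (z : PrimalVec n m) (lam : DualVec p) :
    P.L ξ α δ φ z lam = (P.cost z + α / 2 * ‖z‖ ^ 2) + inner ℝ (P.opA z - P.rhs ξ φ) lam +
      (-δ) / 2 * ‖lam‖ ^ 2 := by
  rw [L, sum_mul_constraint]
  ring

theorem L_eq_primal (ξ α δ φ : ℝ) (z : PrimalVec n m) (lam : DualVec p) :
    P.L ξ α δ φ z lam = (-inner ℝ (P.rhs ξ φ) lam - δ / 2 * ‖lam‖ ^ 2) +
      inner ℝ (P.c + P.adjA lam) z + α / 2 * ‖z‖ ^ 2 := by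
  rw [L_eq_dual, cost_eq_inner, inner_sub_left, inner_add_left, inner_adjA,
    real_inner_comm lam (P.opA z)]
  ring

theorem gradZ_eq (ξ α δ φ : ℝ) (z : PrimalVec n m) (lam : DualVec p) :
    P.gradZ ξ α δ φ z lam = P.c + P.adjA lam + α • z := by
  rw [gradZ]
  simp only [L_eq_primal]
  exact (hasGradientAt_quadratic _ _ _ _).gradient

theorem gradLam_eq (ξ α δ φ : ℝ) (z : PrimalVec n m) (lam : DualVec p) :
    P.gradLam ξ α δ φ z lam = P.opA z - P.rhs ξ φ - δ • lam := by
  rw [gradLam]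
  simp only [L_eq_dual]
  rw [(hasGradientAt_quadratic _ _ _ _).gradient, neg_smul, ← sub_eq_add_neg]

/-! ### Convexity and compactness of the constraint sets -/

section Sets

variable {P}

/-- Compactness and convexity are assumed of the product only; they pass to the factors through
coordinate images, which needs a point of `X` to fill in the other coordinates. -/
theorem CompactConvex.Xfac_eq_image (hX : P.CompactConvex) (i : Fin n) :
    P.Xfac i = (fun x : EuclideanSpace ℝ (Fin n) => x i) '' P.X := by
  obtain ⟨x₀, hx₀⟩ := hX.nonempty
  ext t
  constructor
  · intro ht
    refine ⟨WithLp.toLp 2 (Function.update x₀ i t), fun k => ?_, by simp⟩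
    by_cases hk : k = i
    · subst hk; simpa using ht
    · simpa [hk] using hx₀ k
  · rintro ⟨x, hx, rfl⟩
    exact hx i

theorem CompactConvex.isCompact_Zfac (hX : P.CompactConvex) (ξ : ℝ) (j : Fin n ⊕ Fin m) :
    IsCompact (P.Zfac ξ j) := by
  cases j with
  | inl i =>
    change IsCompact (P.Xfac i)
    rw [hX.Xfac_eq_image]
    exact hX.compact.image (by fun_prop)
  | inr i => exact isCompact_Icc

theorem CompactConvex.convex_Zfac (hX : P.CompactConvex) (ξ : ℝ) (j : Fin n ⊕ Fin m) :
    Convex ℝ (P.Zfac ξ j) := by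
  cases j with
  | inl i =>
    change Convex ℝ (P.Xfac i)
    rw [hX.Xfac_eq_image]
    exact hX.convex.is_linear_image ⟨fun _ _ => rfl, fun _ _ => rfl⟩
  | inr i => exact convex_Icc _ _

theorem CompactConvex.isCompact_Z (hX : P.CompactConvex) (ξ : ℝ) : IsCompact (P.Z ξ) := by
  have h1 : IsCompact (Set.univ.pi (P.Zfac ξ)) := isCompact_univ_pi (hX.isCompact_Zfac ξ)
  have h2 : P.Z ξ = (WithLp.toLp 2 : (Fin n ⊕ Fin m → ℝ) → PrimalVec n m) ''
      Set.univ.pi (P.Zfac ξ) := by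
    ext z
    constructor
    · intro hz
      exact ⟨z.ofLp, fun j _ => hz j, rfl⟩
    · rintro ⟨w, hw, rfl⟩ j
      exact hw j trivial
  rw [h2]
  exact h1.image (PiLp.continuous_toLp 2 _)

theorem CompactConvex.convex_Z (hX : P.CompactConvex) (ξ : ℝ) : Convex ℝ (P.Z ξ) :=
  fun _ hx _ hy _ _ ha hb hab j => hX.convex_Zfac ξ j (hx j) (hy j) ha hb hab

theorem CompactConvex.convex_Zblock (hX : P.CompactConvex) (ξ : ℝ) {N₁ : ℕ}
    (ownP : Fin n ⊕ Fin m → Fin N₁) (i : Fin N₁) : Convex ℝ (P.Zblock ξ ownP i) :=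
  fun _ hx _ hy _ _ ha hb hab j => hX.convex_Zfac ξ j.1 (hx j) (hy j) ha hb hab

theorem CompactConvex.norm_le_r (hX : P.CompactConvex) {ξ : ℝ} {z : PrimalVec n m}
    (hz : z ∈ P.Z ξ) : ‖z‖ ≤ P.r ξ :=
  le_csSup ((hX.isCompact_Z ξ).image continuous_norm).bddAbove ⟨z, hz, rfl⟩

theorem CompactConvex.norm_sub_le (hX : P.CompactConvex) {ξ : ℝ} {z w : PrimalVec n m}
    (hz : z ∈ P.Z ξ) (hw : w ∈ P.Z ξ) : ‖z - w‖ ≤ 2 * P.r ξ := by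
  have h1 := hX.norm_le_r hz
  have h2 := hX.norm_le_r hw
  have h3 := _root_.norm_sub_le z w
  linarith

theorem convex_nonneg_sum_abs_le {ι : Type*} [Fintype ι] (M : ℝ) :
    Convex ℝ {v : EuclideanSpace ℝ ι | (∀ l, 0 ≤ v l) ∧ ∑ l, |v l| ≤ M} := by
  intro x hx y hy a b ha hb hab
  have h0 : ∀ l, 0 ≤ (a • x + b • y) l := fun l => by
    have := mul_nonneg ha (hx.1 l)
    have := mul_nonneg hb (hy.1 l)
    simp only [PiLp.add_apply, PiLp.smul_apply, smul_eq_mul]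
    linarith
  refine ⟨h0, ?_⟩
  have hx2 := hx.2
  have hy2 := hy.2
  simp only [abs_of_nonneg (h0 _), abs_of_nonneg (hx.1 _), abs_of_nonneg (hy.1 _)] at hx2 hy2 ⊢
  simp only [PiLp.add_apply, PiLp.smul_apply, smul_eq_mul, Finset.sum_add_distrib,
    ← Finset.mul_sum]
  calc _ ≤ a * M + b * M := add_le_add (mul_le_mul_of_nonneg_left hx2 ha)
        (mul_le_mul_of_nonneg_left hy2 hb)
    _ = M := by rw [← add_mul, hab, one_mul]

theorem IsSlater.mem_Z {zbar : PrimalVec n m} (h : P.IsSlater zbar) {ξ : ℝ} (hξ : P.xiE ≤ ξ) :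
    zbar ∈ P.Z ξ := by
  intro j
  cases j with
  | inl i => exact h.mem i
  | inr i =>
    have h1 : zbar (Sum.inr i) - (P.yu i : ℝ) - (P.xiE - 1 / 2) < 0 := h.neg (Sum.inr (Sum.inl i))
    have h2 : - zbar (Sum.inr i) + (P.yl i : ℝ) + (1 / 2 - P.xiE) < 0 :=
      h.neg (Sum.inr (Sum.inr i))
    constructor <;> linarith

theorem IsSlater.slack_pos {zbar : PrimalVec n m} (h : P.IsSlater zbar) {ξ φ : ℝ}
    (hξ : P.xiE ≤ ξ) (hφ : 0 ≤ φ) (l : Fin p) :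
    0 < - P.Amul zbar l + P.b l + P.nu ξ l + φ := by
  have h1 : P.Amul zbar l - P.b l - P.nu P.xiE l < 0 := h.neg (Sum.inl l)
  have h2 : P.xiE * (P.omega l : ℝ) ≤ ξ * (P.omega l : ℝ) :=
    mul_le_mul_of_nonneg_right hξ (Nat.cast_nonneg _)
  simp only [nu] at h1 ⊢
  linarith

end Sets

/-! ### Optimality conditions for minimizers and saddle points -/

section Saddle

variable {P} {ξ α δ φ : ℝ} {zbar zhat : PrimalVec n m} {lamhat : DualVec p}

/-- First order optimality condition for the minimization of the Lagrangian over `Z`. -/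
theorem CompactConvex.inner_nonneg_of_min (hX : P.CompactConvex) {lam : DualVec p}
    {v : PrimalVec n m} (hv : v ∈ P.Z ξ)
    (hmin : ∀ z ∈ P.Z ξ, P.L ξ α δ φ v lam ≤ P.L ξ α δ φ z lam) {z : PrimalVec n m}
    (hz : z ∈ P.Z ξ) : 0 ≤ inner ℝ (P.c + P.adjA lam + α • v) (z - v) := by
  simp only [L_eq_primal] at hmin
  exact (hX.convex_Z ξ).inner_nonneg_of_isMinOn_quadratic hv hmin hz

/-- The primal minimizers depend on the dual vector in a co-coercive way. -/
theorem CompactConvex.inner_opA_le (hX : P.CompactConvex) {lam mu : DualVec p}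
    {v w : PrimalVec n m} (hv : v ∈ P.Z ξ) (hw : w ∈ P.Z ξ)
    (hvmin : ∀ z ∈ P.Z ξ, P.L ξ α δ φ v lam ≤ P.L ξ α δ φ z lam)
    (hwmin : ∀ z ∈ P.Z ξ, P.L ξ α δ φ w mu ≤ P.L ξ α δ φ z mu) :
    inner ℝ (lam - mu) (P.opA (v - w)) ≤ -(α * ‖v - w‖ ^ 2) := by
  have h1 := hX.inner_nonneg_of_min hv hvmin hw
  have h2 := hX.inner_nonneg_of_min hw hwmin hv
  rw [← neg_sub v w, inner_neg_right] at h1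
  simp only [inner_add_left, inner_adjA, inner_smul_left, conj_trivial] at h1 h2
  have h3 : ‖v - w‖ ^ 2 = inner ℝ v (v - w) - inner ℝ w (v - w) := by
    rw [← inner_sub_left, real_inner_self_eq_norm_sq]
  rw [inner_sub_left, h3]
  linarith

theorem CompactConvex.norm_argmin_sub_le (hX : P.CompactConvex) (hα : 0 < α) {lam mu : DualVec p}
    {v w : PrimalVec n m} (hv : v ∈ P.Z ξ) (hw : w ∈ P.Z ξ)
    (hvmin : ∀ z ∈ P.Z ξ, P.L ξ α δ φ v lam ≤ P.L ξ α δ φ z lam)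
    (hwmin : ∀ z ∈ P.Z ξ, P.L ξ α δ φ w mu ≤ P.L ξ α δ φ z mu) :
    ‖v - w‖ ≤ P.normA / α * ‖lam - mu‖ := by
  have h1 := hX.inner_opA_le hv hw hvmin hwmin
  have h2 := neg_le_of_abs_le (abs_real_inner_le_norm (lam - mu) (P.opA (v - w)))
  have h3 := mul_le_mul_of_nonneg_left (P.norm_opA_le (v - w)) (norm_nonneg (lam - mu))
  have h4 : ‖v - w‖ * (α * ‖v - w‖) ≤ ‖v - w‖ * (P.normA * ‖lam - mu‖) := by nlinarith
  rw [div_mul_eq_mul_div, le_div_iff₀ hα]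
  rcases (norm_nonneg (v - w)).eq_or_lt with h | h
  · rw [← h, zero_mul]
    exact mul_nonneg P.normA_nonneg (norm_nonneg _)
  · linarith [le_of_mul_le_mul_left h4 h]

theorem CompactConvex.exists_argmin (hX : P.CompactConvex) (hne : (P.Z ξ).Nonempty)
    (lam : DualVec p) :
    ∃ v ∈ P.Z ξ, ∀ z ∈ P.Z ξ, P.L ξ α δ φ v lam ≤ P.L ξ α δ φ z lam := by
  have hc : Continuous fun z => P.L ξ α δ φ z lam := by
    simp only [L_eq_primal]
    fun_prop
  obtain ⟨v, hv, hmin⟩ := (hX.isCompact_Z ξ).exists_isMinOn hne hc.continuousOn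
  exact ⟨v, hv, fun z hz => hmin hz⟩

theorem IsSaddle.dualBound_nonneg (hs : P.IsSaddle ξ α δ φ zbar zhat lamhat) :
    0 ≤ P.dualBound ξ α φ zbar :=
  (Finset.sum_nonneg fun _ _ => abs_nonneg _).trans hs.memLam.2

/-- The bound on the 1-norm of the dual solution is inactive, unless the dual solution is `0`. -/
theorem IsSaddle.sum_lt_dualBound (hX : P.CompactConvex) (hzbar : P.IsSlater zbar)
    (hξ : P.xiE ≤ ξ) (hα : 0 < α) (hδ : 0 < δ) (hφ : 0 ≤ φ)
    (hs : P.IsSaddle ξ α δ φ zbar zhat lamhat) (hM : 0 < P.dualBound ξ α φ zbar) :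
    ∑ l, lamhat l < P.dualBound ξ α φ zbar := by
  by_cases hz : lamhat = 0
  · simpa [hz] using hM
  have hp : Nonempty (Fin p) := by
    by_contra h
    rw [not_nonempty_iff] at h
    exact hz (Subsingleton.elim _ _)
  have h0 : (0 : DualVec p) ∈ P.Lam ξ α φ zbar := ⟨fun _ => le_rfl, by simpa using hM.le⟩
  have h1 := (hs.max_dual 0 h0).trans (hs.min_primal zbar (hzbar.mem_Z hξ))
  set μ : ℝ := ⨅ l : Fin p, (- P.Amul zbar l + P.b l + P.nu ξ l + φ) with hμ
  have hbdd : BddBelow (Set.range fun l : Fin p => - P.Amul zbar l + P.b l + P.nu ξ l + φ) :=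
    (Set.finite_range _).bddBelow
  have hμpos : 0 < μ := by
    obtain ⟨l, hl⟩ := exists_eq_ciInf_of_finite
      (f := fun l : Fin p => - P.Amul zbar l + P.b l + P.nu ξ l + φ)
    rw [hμ, ← hl]
    exact hzbar.slack_pos hξ hφ l
  have h2 : μ * ∑ l, lamhat l ≤ -∑ l, lamhat l * (P.Amul zbar l - P.b l - P.nu ξ l - φ) := by
    rw [Finset.mul_sum, ← Finset.sum_neg_distrib]
    refine Finset.sum_le_sum fun l _ => ?_
    have := mul_le_mul_of_nonneg_left (ciInf_le hbdd l) (hs.memLam.1 l)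
    rw [← hμ] at this
    linarith
  have h3 : 0 < ‖lamhat‖ ^ 2 := by
    have := norm_pos_iff.2 hz
    positivity
  have h4 : -(‖P.c‖ * P.r ξ) ≤ P.cost zhat := by
    rw [cost_eq_inner]
    have e1 := neg_le_of_abs_le (abs_real_inner_le_norm P.c zhat)
    have e2 := mul_le_mul_of_nonneg_left (hX.norm_le_r hs.memZ) (norm_nonneg P.c)
    linarith
  have h5 : 0 ≤ α / 2 * ‖zhat‖ ^ 2 := by positivity
  have h6 : 0 < δ / 2 * ‖lamhat‖ ^ 2 := by positivity
  -- Comparing the saddle value with `L` at `λ = 0` and at `zbar` bounds the 1-norm; the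
  -- regularization term `h6` makes the bound strict.
  simp only [L, norm_zero, PiLp.zero_apply, zero_mul, Finset.sum_const_zero] at h1
  rw [dualBound, ← hμ, lt_div_iff₀ hμpos]
  linarith

/-- First order optimality condition for the dual solution, with the bound on the 1-norm imposed
on each block separately. -/
theorem IsSaddle.inner_le_zero (hX : P.CompactConvex) (hzbar : P.IsSlater zbar)
    (hξ : P.xiE ≤ ξ) (hα : 0 < α) (hδ : 0 < δ) (hφ : 0 ≤ φ)
    (hs : P.IsSaddle ξ α δ φ zbar zhat lamhat) {N₂ : ℕ} (ownD : Fin p → Fin N₂)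
    {lam : DualVec p} (hlam : ∀ q, block ownD q lam ∈ P.LamBlock ξ α φ zbar ownD q) :
    inner ℝ (P.opA zhat - P.rhs ξ φ - δ • lamhat) (lam - lamhat) ≤ 0 := by
  have hpos : ∀ l, 0 ≤ lam l := fun l => (hlam (ownD l)).1 ⟨l, rfl⟩
  have key : ∀ mu ∈ P.Lam ξ α φ zbar,
      inner ℝ (P.opA zhat - P.rhs ξ φ - δ • lamhat) (mu - lamhat) ≤ 0 := by
    intro mu hmu
    have h1 : ∀ x ∈ P.Lam ξ α φ zbar,
        -(P.cost zhat + α / 2 * ‖zhat‖ ^ 2) + inner ℝ (-(P.opA zhat - P.rhs ξ φ)) lamhat +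
          δ / 2 * ‖lamhat‖ ^ 2 ≤
        -(P.cost zhat + α / 2 * ‖zhat‖ ^ 2) + inner ℝ (-(P.opA zhat - P.rhs ξ φ)) x +
          δ / 2 * ‖x‖ ^ 2 := by
      intro x hx
      have h2 := hs.max_dual x hx
      rw [L_eq_dual, L_eq_dual] at h2
      rw [inner_neg_left, inner_neg_left]
      linarith
    have h3 := (convex_nonneg_sum_abs_le _).inner_nonneg_of_isMinOn_quadratic hs.memLam h1 hmu
    have e : -(P.opA zhat - P.rhs ξ φ) + δ • lamhat =
        -(P.opA zhat - P.rhs ξ φ - δ • lamhat) := by abel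
    rw [e, inner_neg_left] at h3
    linarith
  -- If the bound is `0`, every block of `lam` vanishes, so `lam` lies in `Λ` already.
  rcases hs.dualBound_nonneg.eq_or_lt with hM | hM
  · refine key lam ⟨hpos, ?_⟩
    rw [← hM]
    refine (Finset.sum_eq_zero fun l _ => ?_).le
    have h1 := (hlam (ownD l)).2
    rw [← hM] at h1
    have h2 := Finset.single_le_sum (f := fun j => |(block ownD (ownD l) lam) j|)
      (fun j _ => abs_nonneg _) (Finset.mem_univ ⟨l, rfl⟩)
    exact le_antisymm (h2.trans h1) (abs_nonneg _)
  · have hlt := hs.sum_lt_dualBound hX hzbar hξ hα hδ hφ hM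
    set S : ℝ := ∑ l, lam l with hS
    have hS0 : 0 ≤ S := Finset.sum_nonneg fun l _ => hpos l
    have hT0 : 0 ≤ ∑ l, lamhat l := Finset.sum_nonneg fun l _ => hs.memLam.1 l
    set gap : ℝ := P.dualBound ξ α φ zbar - ∑ l, lamhat l with hgap
    have hgap0 : 0 < gap := by linarith
    -- A short step from `lamhat` towards `lam` stays in `Λ`, since it adds at most `t * S ≤ gap` to
    -- the 1-norm.
    set t : ℝ := gap / (gap + S) with ht
    have ht0 : 0 < t := by positivity
    have ht1 : t ≤ 1 := by rw [ht, div_le_one (by positivity)]; linarith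
    have htS : t * S ≤ gap := by
      rw [ht, div_mul_eq_mul_div, div_le_iff₀ (by positivity)]
      nlinarith
    have hnn : ∀ l, 0 ≤ (lamhat + t • (lam - lamhat)) l := fun l => by
      have e1 := mul_nonneg ht0.le (hpos l)
      have e2 := mul_nonneg (sub_nonneg.2 ht1) (hs.memLam.1 l)
      simp only [PiLp.add_apply, PiLp.smul_apply, PiLp.sub_apply, smul_eq_mul]
      linarith
    have h1 := key (lamhat + t • (lam - lamhat)) ⟨hnn, by
      simp only [abs_of_nonneg (hnn _)]
      simp only [PiLp.add_apply, PiLp.smul_apply, PiLp.sub_apply, smul_eq_mul,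
        Finset.sum_add_distrib, ← Finset.mul_sum, Finset.sum_sub_distrib]
      rw [← hS]
      nlinarith⟩
    rw [add_sub_cancel_left, inner_smul_right] at h1
    by_contra hcon
    push Not at hcon
    nlinarith [mul_pos ht0 hcon]

end Saddle

end MILP

/-! ### Effect of the primal and dual updates of a run -/

namespace MILP

variable {n m p : ℕ} {P : MILP n m p}

namespace IsRun

variable {ξ α δ φ γ β : ℝ} {zbar : PrimalVec n m} {N₁ N₂ : ℕ}
  {ownP : Fin n ⊕ Fin m → Fin N₁} {ownD : Fin p → Fin N₂}
  {B : ℕ} {K : Fin N₁ → Set ℕ} {D : Set ℕ}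
  {zP : Fin N₁ → ℕ → PrimalVec n m} {lamP : Fin N₁ → ℕ → DualVec p}
  {zD : Fin N₂ → ℕ → PrimalVec n m} {lamD : Fin N₂ → ℕ → DualVec p}

theorem block_mem_Zblock (run : P.IsRun ξ α δ φ γ β zbar ownP ownD B K D zP lamP zD lamD)
    (i : Fin N₁) (k : ℕ) : block ownP i (zP i k) ∈ P.Zblock ξ ownP i := by
  induction k with
  | zero => exact run.z_init i
  | succ k ih =>
    by_cases hk : k ∈ K i
    · exact (run.z_step i k hk).1
    · rwa [run.z_hold i k hk]

theorem stack_mem_Z (run : P.IsRun ξ α δ φ γ β zbar ownP ownD B K D zP lamP zD lamD) (k : ℕ) :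
    stack ownP zP k ∈ P.Z ξ :=
  fun j => run.block_mem_Zblock (ownP j) k ⟨j, rfl⟩

theorem stack_dual_eq (run : P.IsRun ξ α δ φ γ β zbar ownP ownD B K D zP lamP zD lamD)
    {a b k : ℕ} (hgap : ∀ t ∈ D, t * B ≤ a ∨ b < t * B) (hak : a ≤ k) (hkb : k ≤ b) :
    stack ownD lamD k = stack ownD lamD a := by
  induction k, hak using Nat.le_induction with
  | base => rfl
  | succ k hak ih =>
    rw [← ih (by omega)]
    ext l
    refine (block_congr_iff ownD).1 (run.lam_hold (ownD l) k fun t ht => ?_) l rfl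
    have := hgap t ht
    omega

/-- Stored entries that were never received are arbitrary, but they only meet zero coefficients of
`A`. -/
theorem block_adjA_eq (run : P.IsRun ξ α δ φ γ β zbar ownP ownD B K D zP lamP zD lamD)
    (i : Fin N₁) (k : ℕ) :
    block ownP i (P.adjA (lamP i k)) = block ownP i (P.adjA (stack ownD lamD k)) := by
  refine (block_congr_iff ownP).2 fun j hj => ?_
  rw [adjA_apply, adjA_apply]
  refine Finset.sum_congr rfl fun l _ => ?_
  by_cases hA : P.A l j = 0
  · rw [hA, zero_mul, zero_mul]
  · congr 1
    exact (block_congr_iff ownD).1 (run.send_dual i (ownD l) ⟨l, j, rfl, hj, hA⟩ k) l rfl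

theorem block_opA_eq (run : P.IsRun ξ α δ φ γ β zbar ownP ownD B K D zP lamP zD lamD)
    (q : Fin N₂) {t : ℕ} (ht : t ∈ D) :
    block ownD q (P.opA (zD q (t * B))) = block ownD q (P.opA (stack ownP zP (t * B))) := by
  refine (block_congr_iff ownD).2 fun l hl => ?_
  rw [opA_apply, opA_apply]
  refine Finset.sum_congr rfl fun j _ => ?_
  by_cases hA : P.A l j = 0
  · rw [hA, zero_mul, zero_mul]
  · congr 1
    exact (block_congr_iff ownP).1 (run.send_primal (ownP j) q ⟨l, j, hl, rfl, hA⟩ t ht) j rfl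

/-- One projected gradient step of a primal agent contracts the distance of its block to the
minimizer of the Lagrangian for the current dual vector. -/
theorem block_step_le (run : P.IsRun ξ α δ φ γ β zbar ownP ownD B K D zP lamP zD lamD)
    (hX : P.CompactConvex) (hγ : 0 < γ) (hγα : γ * α ≤ 1) {v : PrimalVec n m} (hv : v ∈ P.Z ξ)
    {i : Fin N₁} {k : ℕ} (hk : k ∈ K i)
    (hmin : ∀ z ∈ P.Z ξ, P.L ξ α δ φ v (stack ownD lamD k) ≤ P.L ξ α δ φ z (stack ownD lamD k)) :
    ‖block ownP i (zP i (k + 1)) - block ownP i v‖ ≤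
      (1 - α * γ) * ‖block ownP i (zP i k) - block ownP i v‖ := by
  have hproj := run.z_step i k hk
  set lam := stack ownD lamD k with hlam
  have hvi : block ownP i v ∈ P.Zblock ξ ownP i := fun j => hv j.1
  have hq : inner ℝ ((block ownP i v - γ • block ownP i (P.gradZ ξ α δ φ v lam)) - block ownP i v)
      (block ownP i (zP i (k + 1)) - block ownP i v) ≤ 0 := by
    obtain ⟨w, hw1, hw2, hw⟩ := exists_block_eq ownP i v (block ownP i (zP i (k + 1)))
    have hwZ : w ∈ P.Z ξ := by
      intro j
      by_cases hj : ownP j = i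
      · rw [hw1 j hj]
        exact hproj.1 ⟨j, hj⟩
      · rw [hw2 j hj]
        exact hv j
    have h1 := hX.inner_nonneg_of_min hv hmin hwZ
    rw [hw] at h1
    rw [gradZ_eq, sub_sub_cancel_left, inner_neg_left, inner_smul_left]
    have := mul_nonneg hγ.le h1
    simpa using this
  have h1 := norm_sub_le_of_variational (hproj.inner_le_zero (hX.convex_Zblock ξ ownP i) hvi) hq
  refine h1.trans (le_of_eq ?_)
  -- The terms `c` and `Aᵀ λ` cancel; only the part `α • z` of the gradient remains.
  have e : block ownP i (zP i k) - γ • block ownP i (P.gradZ ξ α δ φ (zP i k) (lamP i k)) -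
      (block ownP i v - γ • block ownP i (P.gradZ ξ α δ φ v lam)) =
      (1 - α * γ) • (block ownP i (zP i k) - block ownP i v) := by
    rw [gradZ_eq, gradZ_eq]
    simp only [block_add, block_smul, run.block_adjA_eq]
    module
  rw [e, norm_smul, Real.norm_of_nonneg (by linarith)]

/-- Linear convergence of the primal iterates while the dual vector does not change. -/
theorem primal_contraction (run : P.IsRun ξ α δ φ γ β zbar ownP ownD B K D zP lamP zD lamD)
    (hX : P.CompactConvex) (hK : PartiallyAsync K B) (hα : 0 < α) (hγ : 0 < γ) (hγα : γ * α ≤ 1)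
    {s T : ℕ} (hgap : ∀ t ∈ D, t ≤ s ∨ s + T ≤ t)
    {v : PrimalVec n m} (hv : v ∈ P.Z ξ)
    (hmin : ∀ z ∈ P.Z ξ, P.L ξ α δ φ v (stack ownD lamD (s * B)) ≤
      P.L ξ α δ φ z (stack ownD lamD (s * B))) :
    ‖stack ownP zP ((s + T) * B) - v‖ ≤ (1 - α * γ) ^ T * ‖stack ownP zP (s * B) - v‖ := by
  have hq0 : 0 ≤ 1 - α * γ := by linarith
  have hq1 : 1 - α * γ ≤ 1 := by linarith [mul_pos hα hγ]
  refine norm_le_mul_of_block_le ownP (pow_nonneg hq0 T) fun i => ?_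
  simp only [block_sub, block_stack]
  have hstep : ∀ k, s * B ≤ k → k < s * B + T * B → k ∈ K i →
      ‖block ownP i (zP i (k + 1)) - block ownP i v‖ ≤
        (1 - α * γ) * ‖block ownP i (zP i k) - block ownP i v‖ := by
    intro k hk1 hk2 hkK
    refine run.block_step_le hX hγ hγα hv hkK ?_
    rwa [run.stack_dual_eq (b := k) (fun t ht => ?_) hk1 le_rfl]
    rcases hgap t ht with h | h
    · exact Or.inl (Nat.mul_le_mul_right B h)
    · right
      have := Nat.mul_le_mul_right B h
      rw [Nat.add_mul] at this
      omega
  rw [Nat.add_mul]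
  refine le_pow_mul_of_windows (d := fun k => ‖block ownP i (zP i k) - block ownP i v‖) (K := K i)
    hq0 (hK.2 i) (fun k hk1 hk2 => ?_) hstep
  by_cases hk : k ∈ K i
  · exact (hstep k hk1 hk2 hk).trans (mul_le_of_le_one_left (norm_nonneg _) hq1)
  · rw [run.z_hold i k hk]

/-- One dual update does not increase the distance to the dual solution more than the
corresponding unprojected step. -/
theorem dual_step_le (run : P.IsRun ξ α δ φ γ β zbar ownP ownD B K D zP lamP zD lamD)
    (hX : P.CompactConvex) (hzbar : P.IsSlater zbar) (hξ : P.xiE ≤ ξ) (hα : 0 < α) (hδ : 0 < δ)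
    (hφ : 0 ≤ φ) (hβ : 0 < β) {zhat : PrimalVec n m} {lamhat : DualVec p}
    (hs : P.IsSaddle ξ α δ φ zbar zhat lamhat) {t : ℕ} (ht : t ∈ D) :
    ‖stack ownD lamD (t * B) - lamhat‖ ≤
      ‖(1 - β * δ) • (stack ownD lamD (t * B - 1) - lamhat) +
        β • P.opA (stack ownP zP (t * B) - zhat)‖ := by
  set lam := stack ownD lamD (t * B - 1)
  set z := stack ownP zP (t * B)
  have hproj : ∀ q, IsProjOn (P.LamBlock ξ α φ zbar ownD q)
      (block ownD q (lam + β • (P.opA z - P.rhs ξ φ - δ • lam)))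
      (block ownD q (stack ownD lamD (t * B))) := by
    intro q
    have h1 := run.lam_step q t ht
    rw [gradLam_eq] at h1
    simp only [block_add, block_sub, block_smul, run.block_opA_eq q ht] at h1 ⊢
    rw [block_stack, block_stack]
    exact h1
  have hlamhat : ∀ q, block ownD q lamhat ∈ P.LamBlock ξ α φ zbar ownD q := by
    intro q
    refine ⟨fun l => hs.memLam.1 l.1, le_trans ?_ hs.memLam.2⟩
    rw [← Fintype.sum_fiberwise ownD fun l => |lamhat l|]
    exact Finset.single_le_sum (f := fun q => ∑ l : {l // ownD l = q}, |lamhat l|)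
      (fun q _ => Finset.sum_nonneg fun _ _ => abs_nonneg _) (Finset.mem_univ q)
  have h1 := inner_le_zero_of_isProjOn_block ownD (fun q => convex_nonneg_sum_abs_le _) hproj
    hlamhat
  have h2 := hs.inner_le_zero hX hzbar hξ hα hδ hφ ownD fun q => (hproj q).1
  have h3 : inner ℝ ((lamhat + β • (P.opA zhat - P.rhs ξ φ - δ • lamhat)) - lamhat)
      (stack ownD lamD (t * B) - lamhat) ≤ 0 := by
    rw [add_sub_cancel_left, inner_smul_left]
    simpa using mul_nonpos_of_nonneg_of_nonpos hβ.le h2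
  refine (norm_sub_le_of_variational h1 h3).trans (le_of_eq (congrArg _ ?_))
  rw [map_sub]
  module

end IsRun

end MILP

/-! ### Recursion for the dual error -/

/-- The error recursion of an inexact dual ascent step: `w` is the current dual error, `u` the
image of the ideal primal error and `e` the image of the primal inexactness. -/
theorem norm_sq_inexact_step_le {V : Type*} [NormedAddCommGroup V] [InnerProductSpace ℝ V]
    {s β : ℝ} {w u e : V} (h : 2 * s * inner ℝ w u + β * ‖u‖ ^ 2 ≤ 0) (hβ : 0 ≤ β) :
    ‖s • w + β • (u + e)‖ ^ 2 ≤
      (s ^ 2 + β ^ 2) * (‖w‖ ^ 2 + ‖e‖ ^ 2) + 2 * β ^ 2 * (‖u‖ * ‖e‖) := by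
  have h1 := norm_sq_smul_add_smul_le s β w e
  have h2 := norm_add_sq_real (s • w + β • e) (β • u)
  rw [show s • w + β • e + β • u = s • w + β • (u + e) by module] at h2
  simp only [inner_smul_left, inner_smul_right, inner_add_left, norm_smul, mul_pow,
    Real.norm_eq_abs, sq_abs, conj_trivial] at h2
  have h3 := real_inner_le_norm e u
  have h4 := mul_le_mul_of_nonneg_left h3 (sq_nonneg β)
  have h5 := mul_nonneg hβ (neg_nonneg.2 h)
  nlinarith

namespace MILP

variable {n m p : ℕ} {P : MILP n m p}

/-- The error recursion between consecutive dual updates. -/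
theorem CompactConvex.dual_recursion (hX : P.CompactConvex) {ξ α δ φ β qp qd : ℝ} (hα : 0 < α)
    (hβ : 0 < β) (hqd : qd = (1 - β * δ) ^ 2 + β ^ 2)
    (hcase : β * P.normA ^ 2 ≤ 2 * α * (1 - β * δ) ∨ qd * (1 - qp ^ 2) ≤ 2 * β ^ 2 * qp)
    {z v zhat : PrimalVec n m} {lam lamhat : DualVec p} (hz : z ∈ P.Z ξ) (hv : v ∈ P.Z ξ)
    (hzhat : zhat ∈ P.Z ξ)
    (hvmin : ∀ x ∈ P.Z ξ, P.L ξ α δ φ v lam ≤ P.L ξ α δ φ x lam)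
    (hzmin : ∀ x ∈ P.Z ξ, P.L ξ α δ φ zhat lamhat ≤ P.L ξ α δ φ x lamhat)
    (herr : ‖z - v‖ ≤ qp * (2 * P.r ξ)) :
    ‖(1 - β * δ) • (lam - lamhat) + β • P.opA (z - zhat)‖ ^ 2 ≤ qd * ‖lam - lamhat‖ ^ 2 +
      (4 * P.r ξ ^ 2 * qd * qp ^ 2 * P.normA ^ 2 + 8 * P.r ξ ^ 2 * β ^ 2 * qp * P.normA ^ 2) := by
  have hqd0 : 0 ≤ qd := by rw [hqd]; positivity
  have ha := P.normA_nonneg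
  have hr : 0 ≤ P.r ξ := (norm_nonneg z).trans (hX.norm_le_r hz)
  -- In the first case the primal error splits into that of the exact minimizer `v` and the
  -- inexactness `z - v`.
  rcases hcase with hc | hc
  · have e : P.opA (z - zhat) = P.opA (v - zhat) + P.opA (z - v) := by
      rw [← map_add]
      congr 1
      abel
    have hmono := hX.inner_opA_le hv hzhat hvmin hzmin
    have hu := P.norm_opA_le (v - zhat)
    have hs0 : 0 ≤ 1 - β * δ := by
      by_contra hneg
      push Not at hneg
      nlinarith [mul_nonneg hβ.le (sq_nonneg P.normA), mul_pos hα (neg_pos.2 hneg)]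
    have h1 : 2 * (1 - β * δ) * inner ℝ (lam - lamhat) (P.opA (v - zhat)) +
        β * ‖P.opA (v - zhat)‖ ^ 2 ≤ 0 := by
      have e1 : ‖P.opA (v - zhat)‖ ^ 2 ≤ P.normA ^ 2 * ‖v - zhat‖ ^ 2 := by
        rw [← mul_pow]
        gcongr
      have e2 := mul_le_mul_of_nonneg_left e1 hβ.le
      have e3 := mul_le_mul_of_nonneg_left hmono hs0
      have e4 := mul_le_mul_of_nonneg_right hc (sq_nonneg ‖v - zhat‖)
      nlinarith
    have h2 := norm_sq_inexact_step_le (e := P.opA (z - v)) h1 hβ.le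
    have h3 : ‖P.opA (z - v)‖ ≤ P.normA * (qp * (2 * P.r ξ)) :=
      (P.norm_opA_le _).trans (mul_le_mul_of_nonneg_left herr ha)
    have h4 : ‖P.opA (v - zhat)‖ ≤ P.normA * (2 * P.r ξ) :=
      hu.trans (mul_le_mul_of_nonneg_left (hX.norm_sub_le hv hzhat) ha)
    have h5 : ‖P.opA (z - v)‖ ^ 2 ≤ (P.normA * (qp * (2 * P.r ξ))) ^ 2 := by gcongr
    have h6 : ‖P.opA (v - zhat)‖ * ‖P.opA (z - v)‖ ≤
        P.normA * (2 * P.r ξ) * (P.normA * (qp * (2 * P.r ξ))) := by gcongr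
    have h7 := mul_le_mul_of_nonneg_left h5 hqd0
    have h8 := mul_le_mul_of_nonneg_left h6 (sq_nonneg β)
    rw [e]
    rw [← hqd] at h2
    nlinarith
  -- In the second case no splitting is needed: `hc` says that `q_d ≤ q_d q_p² + 2β² q_p`, and
  -- multiplying by `4r²‖A‖²` gives the additive constant.
  · have h1 := norm_sq_smul_add_smul_le (1 - β * δ) β (lam - lamhat) (P.opA (z - zhat))
    have h2 : ‖P.opA (z - zhat)‖ ≤ P.normA * (2 * P.r ξ) :=
      (P.norm_opA_le _).trans (mul_le_mul_of_nonneg_left (hX.norm_sub_le hz hzhat) ha)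
    have h3 : ‖P.opA (z - zhat)‖ ^ 2 ≤ (P.normA * (2 * P.r ξ)) ^ 2 := by gcongr
    have h4 := mul_le_mul_of_nonneg_left h3 hqd0
    have h5 := mul_le_mul_of_nonneg_right hc (sq_nonneg (P.normA * (2 * P.r ξ)))
    rw [← hqd] at h1
    nlinarith

end MILP

/-! ### Summing the recursion and the main theorem -/

theorem le_geometric_of_le_mul_add {x : ℕ → ℝ} {q C : ℝ} (hq : 0 ≤ q) {N : ℕ}
    (h : ∀ k < N, x (k + 1) ≤ q * x k + C) : x N ≤ q ^ N * x 0 + C * ∑ i ∈ Finset.range N, q ^ i := by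
  induction N with
  | zero => simp
  | succ N ih =>
    have h1 := ih fun k hk => h k (by omega)
    have h2 := mul_le_mul_of_nonneg_left h1 hq
    have h3 := h N (Nat.lt_succ_self N)
    rw [geom_sum_succ]
    calc x (N + 1) ≤ q * (q ^ N * x 0 + C * ∑ i ∈ Finset.range N, q ^ i) + C := by linarith
      _ = _ := by ring

/-- Overall primal convergence. The constants `γ₁` and `θ` are those of the linear convergence of
the primal iterates between consecutive dual updates (first part of the last conjunct). -/
theorem theorem5 {n m p : ℕ} (P : MILP n m p) (hX : P.CompactConvex)
    (zbar : PrimalVec n m) (hzbar : P.IsSlater zbar)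
    (ξ : ℝ) (hξe : P.xiE ≤ ξ) (hξ1 : ξ < 1)
    (α δ φ : ℝ) (hα : 0 < α) (hδ : 0 < δ) (hφ : 0 ≤ φ) :
    ∃ γ₁ θ : ℝ, 0 < γ₁ ∧ 0 < θ ∧
      ∀ γ β : ℝ, 0 < γ → γ < γ₁ → 0 < β →
        β < min (2 * α / (P.normA + 2 * α * δ)) (2 * δ / (1 + δ ^ 2)) →
      ∀ qp qd : ℝ, qp = 1 - θ * γ → qd = (1 - β * δ) ^ 2 + β ^ 2 →
        qp ∈ Set.Ico (0 : ℝ) 1 ∧ qd ∈ Set.Ico (0 : ℝ) 1 ∧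
        ∀ (zhat : PrimalVec n m) (lamhat : DualVec p), P.IsSaddle ξ α δ φ zbar zhat lamhat →
        ∀ (N₁ N₂ : ℕ) (ownP : Fin n ⊕ Fin m → Fin N₁) (ownD : Fin p → Fin N₂)
          (B : ℕ) (K : Fin N₁ → Set ℕ) (D : Set ℕ), PartiallyAsync K B → 0 ∉ D →
        ∀ (zP : Fin N₁ → ℕ → PrimalVec n m) (lamP : Fin N₁ → ℕ → DualVec p)
          (zD : Fin N₂ → ℕ → PrimalVec n m) (lamD : Fin N₂ → ℕ → DualVec p),
          P.IsRun ξ α δ φ γ β zbar ownP ownD B K D zP lamP zD lamD →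
        ∀ N : ℕ, 1 ≤ N → (N : ℕ∞) ≤ D.encard →
          (∀ v ∈ P.Z ξ,
            IsMinOn (fun z => P.L ξ α δ φ z (stack ownD lamD (dualTime D (N - 1) * B)))
              (P.Z ξ) v →
            ‖stack ownP zP (dualTime D N * B) - v‖ ≤
              qp ^ (dualTime D N - dualTime D (N - 1)) *
                ‖stack ownP zP (dualTime D (N - 1) * B) - v‖) ∧
          ‖stack ownP zP (dualTime D N * B) - zhat‖ ≤
            2 * qp ^ (dualTime D N - dualTime D (N - 1)) * P.r ξ +
              P.normA / α *
                Real.sqrt (qd ^ (N - 1) * ‖stack ownD lamD 0 - lamhat‖ ^ 2 +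
                  (4 * P.r ξ ^ 2 * qd * qp ^ 2 * P.normA ^ 2 +
                    8 * P.r ξ ^ 2 * β ^ 2 * qp * P.normA ^ 2) *
                    ∑ i ∈ Finset.range N, qd ^ i) := by

  set a := P.normA with ha
  have ha0 : 0 ≤ a := P.normA_nonneg
  set β₀ : ℝ := 2 * α / (a ^ 2 + 2 * α * δ) with hβ₀
  have hden : 0 < a ^ 2 + 2 * α * δ := by positivity
  have hβ₀pos : 0 < β₀ := by positivity
  -- This `γ₁` is chosen so that `1 - q_p ≤ β₀² q_p`, as needed when `β ≥ β₀`; it depends on neither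
  -- `β` nor the run.
  refine ⟨β₀ ^ 2 / (1 + β₀ ^ 2) / α, α, by positivity, hα, ?_⟩
  intro γ β hγ hγ1 hβ hβ1 qp qd hqp hqd
  have hs : α * γ * (1 + β₀ ^ 2) < β₀ ^ 2 := by
    rw [lt_div_iff₀ hα, lt_div_iff₀ (by positivity)] at hγ1
    linarith
  have hαγ : 0 < α * γ := mul_pos hα hγ
  have hαγ1 : α * γ < 1 := by nlinarith
  have hqp0 : 0 ≤ qp := by linarith
  have hqp1 : qp < 1 := by linarith
  have hqd0 : 0 ≤ qd := by rw [hqd]; positivity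
  have hqd1 : qd < 1 := by
    have h1 := hβ1.trans_le (min_le_right _ _)
    rw [lt_div_iff₀ (by positivity)] at h1
    have h2 : β * (β * (1 + δ ^ 2)) < β * (2 * δ) := mul_lt_mul_of_pos_left h1 hβ
    rw [hqd]
    linarith
  have hcase : β * a ^ 2 ≤ 2 * α * (1 - β * δ) ∨ qd * (1 - qp ^ 2) ≤ 2 * β ^ 2 * qp := by
    rcases le_total β β₀ with h | h
    · left
      rw [hβ₀, le_div_iff₀ hden] at h
      linarith
    · right
      have h1 : β₀ ^ 2 ≤ β ^ 2 := by gcongr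
      have h2 : 1 - qp ≤ β₀ ^ 2 * qp := by rw [hqp]; linarith
      have h3 : β₀ ^ 2 * qp ≤ β ^ 2 * qp := mul_le_mul_of_nonneg_right h1 hqp0
      have h4 : 1 - qp ^ 2 ≤ 2 * (1 - qp) := by linarith [sq_nonneg (1 - qp)]
      have h5 : 0 ≤ 1 - qp ^ 2 := by nlinarith
      have h6 := mul_le_of_le_one_left h5 hqd1.le
      linarith
  refine ⟨⟨hqp0, hqp1⟩, ⟨hqd0, hqd1⟩, ?_⟩
  intro zhat lamhat hsad N₁ N₂ ownP ownD B K D hK hD zP lamP zD lamD run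
  have contraction : ∀ N, ((N + 1 : ℕ) : ℕ∞) ≤ D.encard → ∀ v ∈ P.Z ξ,
      (∀ z ∈ P.Z ξ, P.L ξ α δ φ v (stack ownD lamD (dualTime D N * B)) ≤
        P.L ξ α δ φ z (stack ownD lamD (dualTime D N * B))) →
      ‖stack ownP zP (dualTime D (N + 1) * B) - v‖ ≤
        qp ^ (dualTime D (N + 1) - dualTime D N) * ‖stack ownP zP (dualTime D N * B) - v‖ := by
    intro N hN v hv hmin
    have hlt := dualTime_lt_succ hD hN
    have h1 := run.primal_contraction hX hK hα hγ (by linarith)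
      (T := dualTime D (N + 1) - dualTime D N) (fun t ht => ?_) hv hmin
    · rwa [Nat.add_sub_cancel' hlt.le, ← hqp] at h1
    · rcases lt_or_ge t (dualTime D (N + 1)) with h | h
      · exact Or.inl (le_dualTime_of_lt_succ ht h)
      · right; omega
  have hne : (P.Z ξ).Nonempty := ⟨_, hsad.memZ⟩
  have recursion : ∀ N, ((N + 1 : ℕ) : ℕ∞) ≤ D.encard →
      ‖stack ownD lamD (dualTime D (N + 1) * B) - lamhat‖ ^ 2 ≤
        qd * ‖stack ownD lamD (dualTime D N * B) - lamhat‖ ^ 2 +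
          (4 * P.r ξ ^ 2 * qd * qp ^ 2 * a ^ 2 + 8 * P.r ξ ^ 2 * β ^ 2 * qp * a ^ 2) := by
    intro N hN
    have hlt := dualTime_lt_succ hD hN
    have hmul := Nat.mul_lt_mul_of_pos_right hlt hK.1
    obtain ⟨v, hv, hmin⟩ := hX.exists_argmin (α := α) (δ := δ) (φ := φ) hne
      (stack ownD lamD (dualTime D N * B))
    have herr : ‖stack ownP zP (dualTime D (N + 1) * B) - v‖ ≤ qp * (2 * P.r ξ) := by
      refine (contraction N hN v hv hmin).trans ?_
      have h1 : qp ^ (dualTime D (N + 1) - dualTime D N) ≤ qp :=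
        pow_le_of_le_one hqp0 hqp1.le (by omega)
      exact mul_le_mul h1 (hX.norm_sub_le (run.stack_mem_Z _) hv) (norm_nonneg _) hqp0
    have h1 := run.dual_step_le hX hzbar hξe hα hδ hφ hβ hsad (dualTime_mem hN)
    -- The dual vector just before an update is still the one left by the previous update.
    rw [run.stack_dual_eq (a := dualTime D N * B) (b := dualTime D (N + 1) * B - 1)
      (fun t ht => ?_) (by omega) le_rfl] at h1
    · exact (pow_le_pow_left₀ (norm_nonneg _) h1 2).trans
        (hX.dual_recursion hα hβ hqd hcase (run.stack_mem_Z _) hv hsad.memZ hmin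
          hsad.min_primal herr)
    · rcases lt_or_ge t (dualTime D (N + 1)) with h | h
      · exact Or.inl (Nat.mul_le_mul_right B (le_dualTime_of_lt_succ ht h))
      · right
        have := Nat.mul_le_mul_right B h
        omega
  intro N hN1 hN
  obtain ⟨N, rfl⟩ : ∃ k, N = k + 1 := ⟨N - 1, by omega⟩
  rw [Nat.add_sub_cancel]
  refine ⟨fun v hv hmin => contraction N hN v hv fun z hz => hmin hz, ?_⟩
  obtain ⟨v, hv, hmin⟩ := hX.exists_argmin (α := α) (δ := δ) (φ := φ) hne
    (stack ownD lamD (dualTime D N * B))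
  set C := 4 * P.r ξ ^ 2 * qd * qp ^ 2 * a ^ 2 + 8 * P.r ξ ^ 2 * β ^ 2 * qp * a ^ 2 with hC
  have hC0 : 0 ≤ C := by positivity
  have hdual : ‖stack ownD lamD (dualTime D N * B) - lamhat‖ ^ 2 ≤
      qd ^ N * ‖stack ownD lamD 0 - lamhat‖ ^ 2 + C * ∑ i ∈ Finset.range (N + 1), qd ^ i := by
    have h1 := le_geometric_of_le_mul_add
      (x := fun k => ‖stack ownD lamD (dualTime D k * B) - lamhat‖ ^ 2) hqd0 (N := N) fun k hk =>
        recursion k (le_trans (by exact_mod_cast (by omega : k + 1 ≤ N + 1)) hN)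
    simp only [show dualTime D 0 = 0 from rfl, Nat.zero_mul] at h1
    refine h1.trans ?_
    -- Only `N` recursion steps have occurred; the last term of the stated sum is slack.
    rw [Finset.sum_range_succ]
    have : 0 ≤ C * qd ^ N := by positivity
    linarith
  have h1 := (contraction N hN v hv hmin).trans (mul_le_mul_of_nonneg_left
    (hX.norm_sub_le (run.stack_mem_Z _) hv) (pow_nonneg hqp0 _))
  have h2 := hX.norm_argmin_sub_le hα hv hsad.memZ hmin hsad.min_primal
  have h3 := mul_le_mul_of_nonneg_left (Real.le_sqrt_of_sq_le hdual)
    (div_nonneg ha0 hα.le)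
  have h4 := norm_sub_le_norm_sub_add_norm_sub (stack ownP zP (dualTime D (N + 1) * B)) v zhat
  linarith
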